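/- Let $X$ and $A$ be nonempty Borel spaces (Borel subsets of Polish spaces), and let $(X, A, \{A(x)\mid x\in X\}, Q, c)$ be a Markov control model: each $A(x)\subset A$ is nonempty and measurable, the set $\{(x,a)\mid x\in X,\ a\in A(x)\}$ is measurable in $X\times A$, $Q(\mathrm dy\mid x,a)$ is a stochastic kernel on $X$ given this set, and $c$ is a real-valued measurable function on this set. Let $K\subset X$ be measurable, $\alpha\in\,]0,1[$, and put $\mathbb K=\{(x,a)\mid x\in X\setminus K,\ a\in A(x)\}$. Assume that - there is a measurable $f:X\to A$ with $f(x)\in A(x)$ for all $x\in X$, and every $A(x)$ is compact; - on $\mathbb K$ the cost $c$ is nonnegative, lower semicontinuous and inf-compact (that is, $\{a\in A(x)\mid c(x,a)\le r\}$ is compact for all $x\in X\setminus K$ and $r\in\mathbb R$); - $Q$ is strongly Feller on $\mathbb K$: for every bounded measurable $g:X\to\mathbb R$ the map $(x,a)\mapsto\int_X g(y)\,Q(\mathrm dy\mid x,a)$ is continuous on $\mathbb K$; - $c$ is bounded above on $\mathbb K$, and $\widetilde c:=\sup_{\mathbb K}c(x,a)<\infty$ (with $\widetilde c:=0$ if $\mathbb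 K=\emptyset$). A randomized Markov policy is a sequence $\pi=(\varphi_i)_{i\ge 0}$ of stochastic kernels on $A$ given $X$ with $\varphi_i(A(x)\mid x)=1$ for all $x\in X$. Let $\mathsf P^\pi_x$ be the law of the controlled process $(x_i,a_i)_{i\ge 0}$ with $x_0=x$, $a_i\sim\varphi_i(\cdot\mid x_i)$ and $x_{i+1}\sim Q(\cdot\mid x_i,a_i)$, let $\tau=\inf\{i\ge 0\mid x_i\in K\}$ (with $\inf\emptyset=\infty$), and let $$V^\star(x)=\inf_\pi \mathsf E^\pi_x\Bigl[\sum_{i=0}^{\tau-1}\alpha^i c(x_i,a_i)\Bigr],\qquad x\in X\setminus K,$$ the infimum being over all randomized Markov policies. Define the $\alpha$-value iteration functions on $X\setminus K$ by $v_0=0$ and $$v_n(x)=\min_{a\in A(x)}\Bigl[c(x,a)+\alpha\int_{X\setminus K}Q(\mathrm dy\mid x,a)\,v_{n-1}(y)\Bigr],\qquad n\ge 1.$$ Write $\|u\|=\sup_{x\in X\setminus K}|u(x)|$. Then the functions $v_n$ are well defined (the minima are attained) and measurable, and: 1. $\|V^\star\|\le \widetilde c/(1-\alpha)$. 2. For all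 $n\ge 0$ and $x\in X\setminus K$, $V^\star(x)-v_n(x)\le \widetilde c\,\alpha^n/(1-\alpha)$; moreover $\|v_n-V^\star\|\le\widetilde c\,\alpha^n/(1-\alpha)$ for all $n\ge 0$. 3. $V^\star$ is the unique measurable function $\xi:X\setminus K\to[0,\infty]$ with $\|\xi\|<\infty$ that solves the $\alpha$-discounted cost optimality equation ($\alpha$-DCOE) $$\xi(x)=\min_{a\in A(x)}\Bigl[c(x,a)+\alpha\int_{X\setminus K}Q(\mathrm dy\mid x,a)\,\xi(y)\Bigr]\qquad\text{for all }x\in X\setminus K.$$ -/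

import Mathlib

open MeasureTheory ProbabilityTheory Set
open scoped ENNReal

/-- A Markov control model `(X, A, {A(x)}, Q, c)`: feasible action sets `A(x)`, nonempty and
measurable, with measurable graph `{(x, a) | a ∈ A(x)}`, a stochastic kernel `Q` on `X` given the
feasible state-action pairs, and a measurable real cost on the feasible state-action pairs. -/
structure MarkovControlModel (X A : Type*) [MeasurableSpace X] [MeasurableSpace A] where
  /-- The set `A(x)` of feasible actions in state `x`. -/
  feas : X → Set A
  feas_nonempty : ∀ x, (feas x).Nonempty
  measurableSet_feas : ∀ x, MeasurableSet (feas x)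
  measurableSet_graph : MeasurableSet {p : X × A | p.2 ∈ feas p.1}
  /-- The transition law. -/
  Q : Kernel ↥{p : X × A | p.2 ∈ feas p.1} X
  isMarkovKernel_Q : IsMarkovKernel Q
  /-- The cost-per-stage function. -/
  cost : ↥{p : X × A | p.2 ∈ feas p.1} → ℝ
  measurable_cost : Measurable cost

namespace MarkovControlModel

variable {X A : Type*} [MeasurableSpace X] [MeasurableSpace A] (M : MarkovControlModel X A)

/-- The feasible state-action pairs `(x, a)`, `x ∈ X`, `a ∈ A(x)`. -/
abbrev Pairs : Type _ := ↥{p : X × A | p.2 ∈ M.feas p.1}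

/-- The feasible state-action pairs `(x, a)` with `x ∉ K`. -/
def pairsOff (K : Set X) : Set M.Pairs := {z | z.1.1 ∉ K}

instance : IsMarkovKernel M.Q := M.isMarkovKernel_Q

/-- A randomized Markov policy: a sequence of stochastic kernels `φ i` on `A` given `X` with
`φ i (A(x) | x) = 1` for every `x`. -/
structure Policy where
  φ : ℕ → Kernel X A
  isMarkovKernel_φ : ∀ i, IsMarkovKernel (φ i)
  φ_feas : ∀ i x, φ i x (M.feas x) = 1

variable {M}

instance (π : M.Policy) (i : ℕ) : IsMarkovKernel (π.φ i) := π.isMarkovKernel_φ i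

/-- The kernel `x ↦ δ_x(dx') φ_i(da | x')`, as a kernel on the feasible state-action pairs: the
state is `x` and the action is drawn at stage `i` from the policy. -/
noncomputable def Policy.pairKernel (π : M.Policy) (i : ℕ) : Kernel X M.Pairs :=
  (Kernel.id ×ₖ π.φ i).comapRight (MeasurableEmbedding.subtype_coe M.measurableSet_graph)

instance (π : M.Policy) (i : ℕ) : IsMarkovKernel (π.pairKernel i) := by
  refine Kernel.IsMarkovKernel.comapRight _ _ fun x => ?_
  rw [Subtype.range_coe, Kernel.prod_apply, Kernel.id_apply,
    Measure.prod_apply M.measurableSet_graph,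
    lintegral_dirac' x (measurable_measure_prodMk_left M.measurableSet_graph)]
  exact π.φ_feas i x

/-- The conditional law of `(x_{n+1}, a_{n+1})` given `(x_0, a_0, …, x_n, a_n)`: first
`x_{n+1} ∼ Q(· | x_n, a_n)`, then `a_{n+1} ∼ φ_{n+1}(· | x_{n+1})`. -/
noncomputable def Policy.stepKernel (π : M.Policy) (n : ℕ) :
    Kernel (Π _ : Finset.Iic n, M.Pairs) M.Pairs :=
  (π.pairKernel (n + 1) ∘ₖ M.Q).comap
    (fun h : (Π _ : Finset.Iic n, M.Pairs) => h ⟨n, Finset.mem_Iic.2 le_rfl⟩)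
    (measurable_pi_apply _)

instance (π : M.Policy) (n : ℕ) : IsMarkovKernel (π.stepKernel n) := by
  unfold Policy.stepKernel
  infer_instance

/-- The law `P_x^π` of the controlled process `(x_i, a_i)_{i ≥ 0}` started at `x`, on the space of
infinite admissible histories. -/
noncomputable def law (π : M.Policy) (x : X) : Measure (ℕ → M.Pairs) :=
  Kernel.trajMeasure (X := fun _ => M.Pairs) (π.pairKernel 0 x) π.stepKernel

variable (M)

/-- The hitting time `τ = inf {i ≥ 0 | x_i ∈ K}`, with `inf ∅ = ∞`. -/
noncomputable def hitTime (K : Set X) (ω : ℕ → M.Pairs) : ℕ∞ :=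
  ⨅ (i : ℕ) (_ : (ω i).1.1 ∈ K), (i : ℕ∞)

open Classical in
/-- The `α`-discounted expected cost `V(π, x) = E_x^π [∑_{i=0}^{τ-1} α^i c(x_i, a_i)] ∈ [0, ∞]` of
a policy, for a cost that is nonnegative off `K`. -/
noncomputable def policyCost (K : Set X) (α : ℝ) (π : M.Policy) (x : X) : ℝ≥0∞ :=
  ∫⁻ ω, ∑' i : ℕ, (if (i : ℕ∞) < M.hitTime K ω then ENNReal.ofReal (α ^ i * M.cost (ω i)) else 0)
    ∂(law π x)

/-- The `α`-discount value function `V⋆` on `X ∖ K`. -/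
noncomputable def valueFun (K : Set X) (α : ℝ) (x : ↥Kᶜ) : ℝ≥0∞ :=
  ⨅ π : M.Policy, M.policyCost K α π x

/-- `c(x, a) + α ∫_{X ∖ K} Q(dy | x, a) u(y)`, for `u : X ∖ K → [0, ∞]` and a cost that is
nonnegative off `K`. -/
noncomputable def bellmanTerm (K : Set X) (α : ℝ) (u : ↥Kᶜ → ℝ≥0∞) (z : M.Pairs) : ℝ≥0∞ :=
  ENNReal.ofReal (M.cost z) +
    ENNReal.ofReal α * ∫⁻ y : ↥Kᶜ, u y ∂((M.Q z).comap Subtype.val)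

/-- The set of values of `a ↦ c(x, a) + α ∫_{X ∖ K} Q(dy | x, a) u(y)` over `a ∈ A(x)`. -/
def bellmanValues (K : Set X) (α : ℝ) (u : ↥Kᶜ → ℝ≥0∞) (x : ↥Kᶜ) : Set ℝ≥0∞ :=
  M.bellmanTerm K α u '' {z | z.1.1 = (x : X)}

/-- `ξ` solves the `α`-discounted cost optimality equation on `X ∖ K`: `ξ(x)` is the minimum
(which is attained) over `a ∈ A(x)` of `c(x, a) + α ∫_{X ∖ K} Q(dy | x, a) ξ(y)`. -/
def SolvesDCOE (K : Set X) (α : ℝ) (ξ : ↥Kᶜ → ℝ≥0∞) : Prop :=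
  ∀ x, IsLeast (M.bellmanValues K α ξ x) (ξ x)

/-- The `α`-value iteration functions `v_0 = 0`,
`v_{n+1}(x) = min_{a ∈ A(x)} [c(x, a) + α ∫_{X ∖ K} Q(dy | x, a) v_n(y)]` (written with an
infimum). -/
noncomputable def valueIter (K : Set X) (α : ℝ) : ℕ → ↥Kᶜ → ℝ≥0∞
  | 0 => fun _ => 0
  | n + 1 => fun x => sInf (M.bellmanValues K α (valueIter K α n) x)

/-- The standing conditions: the feasible pairs contain the graph of a measurable map; each `A(x)`
is compact; the cost is nonnegative, lower semicontinuous and inf-compact on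
`{(x, a) | x ∉ K, a ∈ A(x)}`; and `Q` is strongly Feller there (the integrals in question are
bounded since `Q` is Markov). -/
structure Regular [TopologicalSpace X] [TopologicalSpace A] (K : Set X) : Prop where
  exists_selector : ∃ f : X → A, Measurable f ∧ ∀ x, f x ∈ M.feas x
  isCompact_feas : ∀ x, IsCompact (M.feas x)
  cost_nonneg : ∀ z ∈ M.pairsOff K, 0 ≤ M.cost z
  cost_lsc : LowerSemicontinuousOn M.cost (M.pairsOff K)
  cost_infCompact : ∀ x ∉ K, ∀ r : ℝ,
    IsCompact {a : A | ∃ z : M.Pairs, z.1 = (x, a) ∧ M.cost z ≤ r}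
  strongFeller : ∀ g : X → ℝ, Measurable g → (∃ C, ∀ y, |g y| ≤ C) →
    ContinuousOn (fun z : M.Pairs => ∫ y, g y ∂(M.Q z)) (M.pairsOff K)

end MarkovControlModel

/-- The supremum norm of a `[0, ∞]`-valued function. -/
noncomputable def supNorm {Y : Type*} (u : Y → ℝ≥0∞) : ℝ≥0∞ := ⨆ y, u y

/-- `sup_y |u(y) - v(y)|`; subtraction in `[0, ∞]` is truncated, so `|u - v|` is the larger of
`u - v` and `v - u`. -/
noncomputable def supDist {Y : Type*} (u v : Y → ℝ≥0∞) : ℝ≥0∞ :=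
  ⨆ y, max (u y - v y) (v y - u y)

/-! Let T send u to the minimum over a ∈ A(x) of c(x, a) + α ∫ u dQ(· | x, a), the integral being
over X ∖ K, and put b = C / (1 - α). T is monotone and multiplies additive errors by α. Since C + αb
= b, all iterates v_n = Tⁿ0 stay in [0, b], and v_m ≤ v_n + αⁿb for all m and n. Hence w = sup v_n
lies within αⁿb of every v_n and satisfies Tw = w (`solvesDCOE_iSup_valueIter`).

A bounded measurable solution ξ of ξ = Tξ must be V⋆ (`SolvesDCOE.eq_valueFun`). Along any policy,
iterating ξ ≤ c + α ∫ ξ dQ bounds ξ by the policy's cost plus a remainder at most αⁿ sup ξ; along a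
stationary policy choosing minimizers the cost is at most ξ. So w = V⋆, and the bounds and
uniqueness follow.

The delicate point is measurability of Tu and of a minimizer. By the strong Feller property the
minimized function is lower semicontinuous in a, and A(x) is compact. Sublevel sets of Tu are then
projections of Borel sets with compact sections. These are Borel by Novikov's theorem
(`measurableSet_image_fst_of_isCompact`), which is derived from separation of a sequence of analytic
sets (`jointlySeparable_of_analyticSet`). -/

/-! ### Novikov separation for sequences of analytic sets -/

/-- A sequence of sets is jointly separable if it can be enlarged to a sequence of measurable sets
with empty intersection. -/
def JointlySeparable {α : Type*} [MeasurableSpace α] (s : ℕ → Set α) : Prop :=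
  ∃ t : ℕ → Set α, (∀ n, s n ⊆ t n) ∧ (∀ n, MeasurableSet (t n)) ∧ ⋂ n, t n = ∅

/-- Take the union of the given enlargements at index `k` and their intersection elsewhere. A common
point lies in some `t i k`, hence in every `t i n` for that same `i`. -/
theorem JointlySeparable.update_iUnion {α : Type*} [MeasurableSpace α] {s : ℕ → Set α} {k : ℕ}
    {u : ℕ → Set α} (h : ∀ i, JointlySeparable (Function.update s k (u i))) :
    JointlySeparable (Function.update s k (⋃ i, u i)) := by
  choose t hst ht hempty using h
  refine ⟨Function.update (fun n => ⋂ i, t i n) k (⋃ i, t i k), fun n => ?_, fun n => ?_, ?_⟩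
  · rcases eq_or_ne n k with rfl | hn
    · simp only [Function.update_self]
      exact iUnion_mono fun i => by simpa using hst i n
    · simp only [Function.update_of_ne hn]
      exact subset_iInter fun i => by simpa [Function.update_of_ne hn] using hst i n
  · rcases eq_or_ne n k with rfl | hn
    · simpa using MeasurableSet.iUnion fun i => ht i n
    · simpa [Function.update_of_ne hn] using MeasurableSet.iInter fun i => ht i n
  · rw [eq_empty_iff_forall_notMem]
    intro x hx
    rw [mem_iInter] at hx
    have hk := hx k
    simp only [Function.update_self, mem_iUnion] at hk
    obtain ⟨i, hi⟩ := hk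
    have : x ∈ ⋂ n, t i n := by
      refine mem_iInter.2 fun n => ?_
      rcases eq_or_ne n k with rfl | hn
      · exact hi
      · have := hx n
        simp only [Function.update_of_ne hn, mem_iInter] at this
        exact this i
    rw [hempty] at this
    exact this

/-- The image under `f n` of the sequences whose coordinates `k` with `Nat.pair n k < m` are
prescribed by `β`. -/
def cylinderImage {α : Type*} (f : ℕ → (ℕ → ℕ) → α) (m : ℕ) (β : ℕ → ℕ) (n : ℕ) : Set α :=
  f n '' {a | ∀ k, Nat.pair n k < m → a k = β (Nat.pair n k)}

theorem cylinderImage_congr {α : Type*} (f : ℕ → (ℕ → ℕ) → α) {m : ℕ} {β γ : ℕ → ℕ}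
    (h : ∀ j < m, β j = γ j) : cylinderImage f m β = cylinderImage f m γ := by
  funext n
  unfold cylinderImage
  congr 1
  ext a
  exact forall_congr' fun k => forall_congr' fun hk => by rw [h _ hk]

/-- With m = `Nat.pair n k`, prescribing `β m` restricts only coordinate k in the n-th set. That set
is the countable union of its restrictions over the possible values, so
`JointlySeparable.update_iUnion` applies contrapositively. -/
theorem exists_not_jointlySeparable_cylinderImage_succ {α : Type*} [MeasurableSpace α]
    (f : ℕ → (ℕ → ℕ) → α) (m : ℕ) (β : ℕ → ℕ)
    (h : ¬ JointlySeparable (cylinderImage f m β)) :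
    ∃ i, ¬ JointlySeparable (cylinderImage f (m + 1) (Function.update β m i)) := by
  contrapose! h
  obtain ⟨⟨n, k⟩, hm⟩ : ∃ p : ℕ × ℕ, Nat.pair p.1 p.2 = m := ⟨Nat.unpair m, Nat.pair_unpair m⟩
  simp only at hm
  have hsplit : cylinderImage f m β = Function.update (cylinderImage f m β) n
      (⋃ i, cylinderImage f (m + 1) (Function.update β m i) n) := by
    rw [eq_comm, Function.update_eq_self_iff]
    unfold cylinderImage
    rw [← image_iUnion]
    congr 1
    ext a
    simp only [mem_iUnion, mem_ofPred_eq]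
    constructor
    · rintro ⟨i, hi⟩ l hl
      simpa [hl.ne] using hi l (by omega)
    · intro ha
      refine ⟨a k, fun l hl => ?_⟩
      rcases eq_or_ne (Nat.pair n l) m with h | h
      · have : l = k := by
          rw [← hm] at h
          exact (Nat.pair_eq_pair.1 h).2
        rw [h, this, Function.update_self]
      · rw [Function.update_of_ne h]
        exact ha l (by omega)
  rw [hsplit]
  refine JointlySeparable.update_iUnion fun i => ?_
  convert! h i using 1
  rw [Function.update_eq_iff]
  refine ⟨rfl, fun l hl => ?_⟩
  unfold cylinderImage
  congr 1
  ext a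
  refine forall_congr' fun j => ?_
  have hne : Nat.pair l j ≠ m := by
    rw [← hm]
    exact fun h => hl (Nat.pair_eq_pair.1 h).1
  rw [Function.update_of_ne hne]
  constructor
  · exact fun h h' => h (by omega)
  · exact fun h h' => h (by omega)

/-- If separation failed, fixing one coordinate at a time would give sequences `a n` whose shrinking
cylinder images are never jointly separable. As the ranges have no common point, two of the points
`f n (a n)` differ; disjoint neighbourhoods of these eventually contain the corresponding images, a
contradiction. -/
theorem jointlySeparable_range {α : Type*} [TopologicalSpace α] [T2Space α] [MeasurableSpace α]
    [OpensMeasurableSpace α] {f : ℕ → (ℕ → ℕ) → α} (hf : ∀ n, Continuous (f n))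
    (h : ⋂ n, range (f n) = ∅) : JointlySeparable fun n => range (f n) := by
  by_contra hns
  choose! g hg using exists_not_jointlySeparable_cylinderImage_succ f
  let S : ℕ → ℕ → ℕ := fun m => Nat.rec (fun _ => 0) (fun m β => Function.update β m (g m β)) m
  have hS : ∀ m, S (m + 1) = Function.update (S m) m (g m (S m)) := fun m => rfl
  have hns' : ∀ m, ¬ JointlySeparable (cylinderImage f m (S m)) := by
    intro m
    induction m with
    | zero =>
      have : cylinderImage f 0 (S 0) = fun n => range (f n) := by
        funext n
        simp [cylinderImage]
      rwa [this]
    | succ m ih => exact hg m _ ih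
  let β : ℕ → ℕ := fun m => g m (S m)
  have hβ : ∀ m, ∀ j < m, S m j = β j := by
    intro m
    induction m with
    | zero => simp
    | succ m ih =>
      intro j hj
      rw [hS]
      rcases eq_or_ne j m with rfl | hne
      · simp [β]
      · rw [Function.update_of_ne hne]
        exact ih j (by omega)
  have hnβ : ∀ m, ¬ JointlySeparable (cylinderImage f m β) := fun m => by
    rw [← cylinderImage_congr f (hβ m)]
    exact hns' m
  let a : ℕ → ℕ → ℕ := fun n k => β (Nat.pair n k)
  obtain ⟨j, hj⟩ : ∃ j, f j (a j) ≠ f 0 (a 0) := by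
    by_contra! hall
    have : f 0 (a 0) ∈ ⋂ n, range (f n) := mem_iInter.2 fun n => ⟨a n, hall n⟩
    rw [h] at this
    exact this
  have hj0 : j ≠ 0 := by
    rintro rfl
    exact hj rfl
  obtain ⟨u, v, hu, hv, hju, h0v, huv⟩ := t2_separation hj
  have key : ∀ (n : ℕ) (w : Set α), IsOpen w → f n (a n) ∈ w →
      ∃ N, ∀ m ≥ N, cylinderImage f m β n ⊆ w := by
    intro n w hw hnw
    obtain ⟨_, ⟨y, N, rfl⟩, hy, hsub⟩ :=
      (PiNat.isTopologicalBasis_cylinders (E := fun _ => ℕ)).exists_subset_of_mem_open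
        (show a n ∈ f n ⁻¹' w from hnw) (hw.preimage (hf n))
    -- `Nat.pair` is increasing in its second argument, so by this stage the first N coordinates of
    -- the n-th sequence are all fixed.
    refine ⟨Nat.pair n N, fun m hm => ?_⟩
    rintro _ ⟨b, hb, rfl⟩
    refine hsub ?_
    intro i hi
    rw [← hy i hi]
    exact hb i ((Nat.pair_lt_pair_right n hi).trans_le hm)
  obtain ⟨N, hN⟩ := key j u hu hju
  obtain ⟨N', hN'⟩ := key 0 v hv h0v
  refine hnβ (max N N') ⟨fun n => if n = j then u else if n = 0 then v else univ, fun n => ?_,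
    fun n => ?_, ?_⟩
  · dsimp only
    split_ifs with h1 h2
    · subst h1
      exact hN _ (le_max_left _ _)
    · subst h2
      exact hN' _ (le_max_right _ _)
    · exact subset_univ _
  · dsimp only
    split_ifs
    exacts [hu.measurableSet, hv.measurableSet, MeasurableSet.univ]
  · rw [eq_empty_iff_forall_notMem]
    intro x hx
    rw [mem_iInter] at hx
    have h1 := hx j
    have h2 := hx 0
    simp only [if_true, hj0.symm, if_false] at h1 h2
    exact huv.le_bot ⟨h1, h2⟩

/-- **Novikov's separation theorem**: a sequence of analytic sets with empty intersection can be
enlarged to a sequence of measurable sets with empty intersection. -/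
theorem jointlySeparable_of_analyticSet {α : Type*} [TopologicalSpace α] [T2Space α]
    [MeasurableSpace α] [OpensMeasurableSpace α] {s : ℕ → Set α} (hs : ∀ n, AnalyticSet (s n))
    (h : ⋂ n, s n = ∅) : JointlySeparable s := by
  by_cases hempty : ∃ n, s n = ∅
  · obtain ⟨n, hn⟩ := hempty
    refine ⟨fun k => if k = n then ∅ else univ, fun k => ?_, fun k => ?_, ?_⟩
    · dsimp only
      split_ifs with hk
      · rw [hk, hn]
      · exact subset_univ _
    · dsimp only
      split_ifs
      exacts [MeasurableSet.empty, MeasurableSet.univ]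
    · exact eq_empty_of_subset_empty ((iInter_subset _ n).trans (by simp))
  · have : ∀ n, ∃ f : (ℕ → ℕ) → α, Continuous f ∧ range f = s n := fun n => by
      have := hs n
      rw [AnalyticSet] at this
      exact this.resolve_left fun h' => hempty ⟨n, h'⟩
    choose f hf hfs using this
    simp only [← hfs] at h
    have := jointlySeparable_range hf h
    simpa only [hfs] using this

/-! ### Projections of Borel sets with compact sections -/

theorem exists_continuous_injective_pi_Icc (Y : Type*) [TopologicalSpace Y]
    [TopologicalSpace.MetrizableSpace Y] [SecondCountableTopology Y] :
    ∃ j : Y → ℕ → Icc (0 : ℝ) 1, Continuous j ∧ Function.Injective j := by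
  rcases isEmpty_or_nonempty Y with hY | hY
  · exact ⟨fun y => isEmptyElim y, continuous_of_discreteTopology, fun y => isEmptyElim y⟩
  let := TopologicalSpace.metrizableSpaceMetric Y
  let q := TopologicalSpace.denseSeq Y
  refine ⟨fun y n => projIcc 0 1 zero_le_one (dist y (q n)), ?_, ?_⟩
  · exact continuous_pi fun n => continuous_projIcc.comp (continuous_id.dist continuous_const)
  · intro y y' h
    refine eq_of_forall_dist_le fun ε hε => ?_
    -- A radius of at most 1 keeps this distance below the truncation level, so equal truncated
    -- distances are equal distances.
    obtain ⟨n, hn⟩ := (TopologicalSpace.denseRange_denseSeq Y).exists_dist_lt y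
      (ε := min (ε / 2) 1) (by positivity)
    have h1 : dist y (q n) < ε / 2 := hn.trans_le (min_le_left _ _)
    have h2 : dist y (q n) < 1 := hn.trans_le (min_le_right _ _)
    have h3 := congrArg Subtype.val (congrFun h n)
    simp only [coe_projIcc] at h3
    rw [min_eq_right h2.le, max_eq_right dist_nonneg] at h3
    have h4 : dist y' (q n) = dist y (q n) := by
      rw [max_eq_right (le_min zero_le_one dist_nonneg)] at h3
      rcases min_choice 1 (dist y' (q n)) with h5 | h5 <;> rw [h5] at h3 <;> linarith
    have := dist_triangle_right y y' (q n)
    linarith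

/-- Off the projection the empty section is witnessed by finitely many basic sets covering Y, each
missing the section. The set of x whose section misses `V n` is only coanalytic, so Borel sets `C n`
inside it are needed that still suffice for a cover; Novikov separation supplies them. -/
theorem measurableSet_image_fst_of_isCompact_of_compactSpace {S Y : Type*} [MeasurableSpace S]
    [StandardBorelSpace S] [TopologicalSpace Y] [PolishSpace Y] [CompactSpace Y]
    [MeasurableSpace Y] [BorelSpace Y] {B : Set (S × Y)} (hB : MeasurableSet B)
    (hc : ∀ x, IsCompact {y | (x, y) ∈ B}) : MeasurableSet (Prod.fst '' B) := by
  let := upgradeStandardBorel S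
  obtain ⟨b, hbc, -, hb⟩ := TopologicalSpace.exists_countable_basis Y
  -- Adding ∅ makes the basis nonempty, so that ℕ enumerates it.
  obtain ⟨V, hV⟩ := (hbc.insert ∅).exists_eq_range (insert_nonempty _ _)
  have hVo : ∀ n, IsOpen (V n) := fun n => by
    have : V n ∈ insert ∅ b := hV ▸ mem_range_self n
    rcases this with h | h
    · rw [h]; exact isOpen_empty
    · exact hb.isOpen h
  have hVb : ∀ (y : Y) (W : Set Y), y ∈ W → IsOpen W → ∃ n, y ∈ V n ∧ V n ⊆ W := by
    intro y W hy hW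
    obtain ⟨v, hv, hyv, hvW⟩ := hb.exists_subset_of_mem_open hy hW
    have : v ∈ range V := hV ▸ mem_insert_of_mem _ hv
    obtain ⟨n, rfl⟩ := this
    exact ⟨n, hyv, hvW⟩
  let P : ℕ → Set S := fun n => Prod.fst '' (B ∩ Prod.snd ⁻¹' V n)
  have hP : ∀ n, AnalyticSet (P n) := fun n =>
    (hB.inter (measurable_snd (hVo n).measurableSet)).analyticSet_image measurable_fst
  -- Points outside `B` for which `V n` fails to witness this: either `V n` meets the section or it
  -- misses y. Closed sections make the intersection of all `Z n` empty.
  let Z : ℕ → Set (S × Y) := fun n => (fun p : (S × Y) × Y => (p.1.1, p.2)) ''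
    {p | (p.1.1, p.2) ∉ B ∧ ((p.1 ∈ B ∧ p.1.2 ∈ V n) ∨ p.2 ∉ V n)}
  have hZ : ∀ n, AnalyticSet (Z n) := fun n => by
    refine MeasurableSet.analyticSet_image ?_ (by fun_prop)
    have hVn := (hVo n).measurableSet
    refine MeasurableSet.inter ?_ (MeasurableSet.union (MeasurableSet.inter ?_ ?_) ?_)
    · exact (show Measurable fun p : (S × Y) × Y => (p.1.1, p.2) by fun_prop) hB.compl
    · exact measurable_fst hB
    · exact (show Measurable fun p : (S × Y) × Y => p.1.2 by fun_prop) hVn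
    · exact measurable_snd hVn.compl
  have hmemZ : ∀ n x y, (x, y) ∉ B → (x, y) ∉ Z n → x ∉ P n ∧ y ∈ V n := by
    intro n x y hxy hz
    constructor
    · rintro ⟨⟨x', y'⟩, ⟨h1, h2⟩, rfl⟩
      exact hz ⟨((x', y'), y), ⟨hxy, Or.inl ⟨h1, h2⟩⟩, rfl⟩
    · by_contra hy
      exact hz ⟨((x, y), y), ⟨hxy, Or.inr hy⟩, rfl⟩
  have hZe : ⋂ n, Z n = ∅ := by
    rw [eq_empty_iff_forall_notMem]
    rintro ⟨x, y⟩ hxy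
    rw [mem_iInter] at hxy
    have hnB : (x, y) ∉ B := by
      obtain ⟨⟨⟨a, b⟩, c⟩, ⟨h1, -⟩, h2⟩ := hxy 0
      rw [← h2]; exact h1
    obtain ⟨n, hyn, hn⟩ := hVb y {y | (x, y) ∈ B}ᶜ hnB (hc x).isClosed.isOpen_compl
    obtain ⟨⟨⟨a, b⟩, c⟩, ⟨-, h1⟩, h2⟩ := hxy n
    simp only [Prod.mk.injEq] at h2
    obtain ⟨rfl, rfl⟩ := h2
    rcases h1 with ⟨h1, h3⟩ | h1
    · exact hn h3 h1
    · exact h1 hyn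
  obtain ⟨t, hZt, htm, hte⟩ := jointlySeparable_of_analyticSet hZ hZe
  -- The complement of `B` is covered by the Borel sets `Bᶜ \ t n`. On each, `V n` contains y and
  -- misses the section, so its projection is disjoint from `P n`.
  have hsep : ∀ n, MeasurablySeparable (Prod.fst '' (Bᶜ \ t n)) (P n) := fun n => by
    refine AnalyticSet.measurablySeparable
      ((hB.compl.diff (htm n)).analyticSet_image measurable_fst) (hP n) ?_
    rw [Set.disjoint_left]
    rintro _ ⟨⟨x, y⟩, ⟨h1, h2⟩, rfl⟩
    exact (hmemZ n x y h1 fun h => h2 (hZt n h)).1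
  choose C hC hCP hCm using hsep
  have hcover : (Prod.fst '' B)ᶜ =
      ⋃ F : {F : Finset ℕ // ⋃ n ∈ F, V n = univ}, ⋂ n ∈ F.1, C n := by
    ext x
    simp only [mem_compl_iff, mem_iUnion, mem_iInter]
    constructor
    · intro hx
      have hcov : univ ⊆ ⋃ n : {n // x ∈ C n}, V n := by
        intro y _
        have hxy : (x, y) ∉ B := fun h => hx ⟨_, h, rfl⟩
        obtain ⟨n, hn⟩ : ∃ n, (x, y) ∉ t n := by
          by_contra! hall
          have : (x, y) ∈ ⋂ n, t n := mem_iInter.2 hall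
          rw [hte] at this
          exact this
        exact mem_iUnion.2 ⟨⟨n, hC n ⟨_, ⟨hxy, hn⟩, rfl⟩⟩,
          (hmemZ n x y hxy fun h => hn (hZt n h)).2⟩
      obtain ⟨F, hF⟩ := isCompact_univ.elim_finite_subcover
        (fun n : {n // x ∈ C n} => V n) (fun n => hVo n) hcov
      classical
      refine ⟨⟨F.image Subtype.val, ?_⟩, ?_⟩
      · rw [eq_univ_iff_forall]
        intro y
        have := hF (mem_univ y)
        simp only [mem_iUnion] at this ⊢
        obtain ⟨n, hn, hy⟩ := this
        exact ⟨n, Finset.mem_image_of_mem _ hn, hy⟩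
      · intro n hn
        obtain ⟨m, -, rfl⟩ := Finset.mem_image.1 hn
        exact m.2
    · rintro ⟨⟨F, hF⟩, hx⟩ ⟨⟨x', y⟩, hxy, rfl⟩
      have : y ∈ ⋃ n ∈ F, V n := hF ▸ mem_univ y
      simp only [mem_iUnion] at this
      obtain ⟨n, hn, hy⟩ := this
      exact Set.disjoint_left.1 (hCP n) ⟨_, ⟨hxy, hy⟩, rfl⟩ (hx n hn)
  rw [← MeasurableSet.compl_iff, hcover]
  exact MeasurableSet.iUnion fun F => Finset.measurableSet_biInter _ fun n _ => hCm n

/-- **Novikov's projection theorem**: the projection of a Borel set with compact sections is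
Borel. -/
theorem measurableSet_image_fst_of_isCompact {S Y : Type*} [MeasurableSpace S]
    [StandardBorelSpace S] [TopologicalSpace Y] [TopologicalSpace.MetrizableSpace Y]
    [SecondCountableTopology Y] [MeasurableSpace Y] [BorelSpace Y] [StandardBorelSpace Y]
    {B : Set (S × Y)} (hB : MeasurableSet B) (hc : ∀ x, IsCompact {y | (x, y) ∈ B}) :
    MeasurableSet (Prod.fst '' B) := by
  obtain ⟨j, hj, hinj⟩ := exists_continuous_injective_pi_Icc Y
  -- A continuous injection suffices: it preserves compact sections, and by Lusin–Souslin it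
  -- preserves Borel sets.
  have hje : MeasurableEmbedding j := hj.measurable.measurableEmbedding hinj
  have hemb : MeasurableEmbedding (Prod.map (id : S → S) j) := MeasurableEmbedding.id.prodMap hje
  have : Prod.fst '' B = Prod.fst '' (Prod.map id j '' B) := by
    rw [image_image]; rfl
  rw [this]
  refine measurableSet_image_fst_of_isCompact_of_compactSpace (hemb.measurableSet_image.2 hB)
    fun x => ?_
  convert! (hc x).image hj using 1
  ext y
  simp only [mem_ofPred_eq, mem_image, Prod.exists, Prod.map_apply, id_eq, Prod.mk.injEq]
  constructor
  · rintro ⟨a, b, h, rfl, rfl⟩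
    exact ⟨b, h, rfl⟩
  · rintro ⟨b, h, rfl⟩
    exact ⟨x, b, h, rfl, rfl⟩

/-! ### Measurable selection of minimizers -/

/-- The graph of the argmin correspondence of `F` over the sections of `D`. -/
def argminGraph {S Y : Type*} (D : Set (S × Y)) (F : S × Y → ℝ≥0∞) : Set (S × Y) :=
  D ∩ {p | F p ≤ ⨅ y ∈ {y | (p.1, y) ∈ D}, F (p.1, y)}

theorem mem_argminGraph {S Y : Type*} {D : Set (S × Y)} {F : S × Y → ℝ≥0∞} {x : S} {y : Y} :
    (x, y) ∈ argminGraph D F ↔ (x, y) ∈ D ∧ ∀ z, (x, z) ∈ D → F (x, y) ≤ F (x, z) := by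
  rw [argminGraph, mem_inter_iff, mem_ofPred_eq, le_iInf₂_iff]
  rfl

section Selection

variable {S Y : Type*} [MeasurableSpace S] [StandardBorelSpace S] [TopologicalSpace Y]
  [TopologicalSpace.MetrizableSpace Y] [SecondCountableTopology Y] [MeasurableSpace Y]
  [BorelSpace Y] [StandardBorelSpace Y] {D : Set (S × Y)}

/-- The infimum of a measurable function over the sections of a measurable set with compact
sections is measurable, if the function is lower semicontinuous on the sections. -/
theorem measurable_biInf_of_isCompact (hD : MeasurableSet D)
    (hne : ∀ x, {y | (x, y) ∈ D}.Nonempty) (hc : ∀ x, IsCompact {y | (x, y) ∈ D})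
    {F : S × Y → ℝ≥0∞} (hF : Measurable F)
    (hl : ∀ x, LowerSemicontinuousOn (fun y => F (x, y)) {y | (x, y) ∈ D}) :
    Measurable fun x => ⨅ y ∈ {y | (x, y) ∈ D}, F (x, y) := by
  refine measurable_of_Iic fun r => ?_
  have : (fun x => ⨅ y ∈ {y | (x, y) ∈ D}, F (x, y)) ⁻¹' Iic r =
      Prod.fst '' (D ∩ F ⁻¹' Iic r) := by
    ext x
    constructor
    · intro hx
      rw [mem_preimage, mem_Iic] at hx
      obtain ⟨y, hy, hmin⟩ := (hl x).exists_isMinOn (hne x) (hc x)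
      exact ⟨(x, y), ⟨hy, mem_Iic.2 ((le_iInf₂ fun z hz => hmin hz).trans hx)⟩, rfl⟩
    · rintro ⟨⟨x', y⟩, ⟨h1, h2⟩, rfl⟩
      exact mem_Iic.2 ((iInf₂_le (f := fun y _ => F (x', y)) y h1).trans (mem_Iic.1 h2))
  rw [this]
  exact measurableSet_image_fst_of_isCompact (hD.inter (hF measurableSet_Iic)) fun x =>
    (hl x).isCompact_inter_preimage_Iic (hc x) r

theorem argminGraph_spec (hD : MeasurableSet D)
    (hne : ∀ x, {y | (x, y) ∈ D}.Nonempty) (hc : ∀ x, IsCompact {y | (x, y) ∈ D})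
    {F : S × Y → ℝ≥0∞} (hF : Measurable F)
    (hl : ∀ x, LowerSemicontinuousOn (fun y => F (x, y)) {y | (x, y) ∈ D}) :
    MeasurableSet (argminGraph D F) ∧ (∀ x, {y | (x, y) ∈ argminGraph D F}.Nonempty) ∧
      ∀ x, IsCompact {y | (x, y) ∈ argminGraph D F} := by
  refine ⟨hD.inter (measurableSet_le hF
    ((measurable_biInf_of_isCompact hD hne hc hF hl).comp measurable_fst)), fun x => ?_,
    fun x => (hl x).isCompact_inter_preimage_Iic (hc x)
      (⨅ y ∈ {y | (x, y) ∈ D}, F (x, y))⟩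
  obtain ⟨y, hy, hmin⟩ := (hl x).exists_isMinOn (hne x) (hc x)
  exact ⟨y, mem_argminGraph.2 ⟨hy, fun z hz => hmin hz⟩⟩

/-- A measurable set with nonempty compact sections admits a measurable selector. -/
theorem exists_measurable_selector (hD : MeasurableSet D)
    (hne : ∀ x, {y | (x, y) ∈ D}.Nonempty) (hc : ∀ x, IsCompact {y | (x, y) ∈ D}) :
    ∃ f : S → Y, Measurable f ∧ ∀ x, (x, f x) ∈ D := by
  obtain ⟨j, hj, hinj⟩ := exists_continuous_injective_pi_Icc Y
  let c : ℕ → S × Y → ℝ≥0∞ := fun k p => ENNReal.ofReal (j p.2 k)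
  have hcont : ∀ k, Continuous fun y => ENNReal.ofReal (j y k : ℝ) := fun k =>
    ENNReal.continuous_ofReal.comp (continuous_subtype_val.comp ((continuous_apply k).comp hj))
  have hcm : ∀ k, Measurable (c k) := fun k => (hcont k).measurable.comp measurable_snd
  -- Minimize the coordinates of the embedding `j` successively. Compactness leaves a point in each
  -- section, and injectivity of `j` leaves only one.
  let E : ℕ → Set (S × Y) := fun k => Nat.rec D (fun k D' => argminGraph D' (c k)) k
  have hE : ∀ k, E (k + 1) = argminGraph (E k) (c k) := fun k => rfl
  have hspec : ∀ k, MeasurableSet (E k) ∧ (∀ x, {y | (x, y) ∈ E k}.Nonempty) ∧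
      ∀ x, IsCompact {y | (x, y) ∈ E k} := by
    intro k
    induction k with
    | zero => exact ⟨hD, hne, hc⟩
    | succ k ih =>
      exact argminGraph_spec ih.1 ih.2.1 ih.2.2 (hcm k) fun x =>
        (hcont k).lowerSemicontinuous.lowerSemicontinuousOn _
  have hinter : ∀ x, (⋂ k, {y | (x, y) ∈ E k}).Nonempty := fun x =>
    IsCompact.nonempty_iInter_of_sequence_nonempty_isCompact_isClosed _
      (fun k y hy => hy.1) (fun k => (hspec k).2.1 x) ((hspec 0).2.2 x)
      fun k => ((hspec k).2.2 x).isClosed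
  choose f hf using hinter
  simp only [mem_iInter, mem_ofPred_eq] at hf
  have hunique : ∀ x y, (∀ k, (x, y) ∈ E k) → y = f x := by
    intro x y hy
    refine hinj (funext fun k => Subtype.ext ?_)
    have h1 : c k (x, y) ≤ c k (x, f x) := (mem_argminGraph.1 (hy (k + 1))).2 _ (hf x k)
    have h2 : c k (x, f x) ≤ c k (x, y) := (mem_argminGraph.1 (hf x (k + 1))).2 _ (hy k)
    exact le_antisymm ((ENNReal.ofReal_le_ofReal_iff (j (f x) k).2.1).1 h1)
      ((ENNReal.ofReal_le_ofReal_iff (j y k).2.1).1 h2)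
  refine ⟨f, fun T hT => ?_, fun x => hf x 0⟩
  have : f ⁻¹' T = Prod.fst '' ((⋂ k, E k) ∩ Prod.snd ⁻¹' T) := by
    ext x
    constructor
    · exact fun hx => ⟨(x, f x), ⟨mem_iInter.2 (hf x), hx⟩, rfl⟩
    · rintro ⟨⟨x', y⟩, ⟨h1, h2⟩, rfl⟩
      rw [mem_iInter] at h1
      rw [mem_preimage, ← hunique x' y h1]
      exact h2
  rw [this]
  refine measurableSet_image_fst_of_isCompact
    ((MeasurableSet.iInter fun k => (hspec k).1).inter (measurable_snd hT)) fun x => ?_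
  refine Set.Subsingleton.isCompact fun y hy y' hy' => ?_
  rw [hunique x y (mem_iInter.1 hy.1), hunique x y' (mem_iInter.1 hy'.1)]

theorem exists_measurable_argmin (hD : MeasurableSet D)
    (hne : ∀ x, {y | (x, y) ∈ D}.Nonempty) (hc : ∀ x, IsCompact {y | (x, y) ∈ D})
    {F : S × Y → ℝ≥0∞} (hF : Measurable F)
    (hl : ∀ x, LowerSemicontinuousOn (fun y => F (x, y)) {y | (x, y) ∈ D}) :
    ∃ f : S → Y, Measurable f ∧ ∀ x, (x, f x) ∈ D ∧ ∀ y, (x, y) ∈ D → F (x, f x) ≤ F (x, y) := by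
  obtain ⟨hm, hne', hc'⟩ := argminGraph_spec hD hne hc hF hl
  obtain ⟨f, hf, hfD⟩ := exists_measurable_selector hm hne' hc'
  exact ⟨f, hf, fun x => mem_argminGraph.1 (hfD x)⟩

end Selection

/-! ### Expectations under the law of the controlled process -/

namespace MarkovControlModel

variable {X A : Type*} [MeasurableSpace X] [MeasurableSpace A] {M : MarkovControlModel X A}

/-- The inequality is enough, since it serves only to show that sets are null. -/
theorem Policy.pairKernel_preimage_le (π : M.Policy) (i : ℕ) (x : X) {T : Set (X × A)}
    (hT : MeasurableSet T) :
    π.pairKernel i x (Subtype.val ⁻¹' T) ≤ π.φ i x (Prod.mk x ⁻¹' T) := by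
  rw [Policy.pairKernel, Kernel.comapRight_apply' _ _ _ (measurable_subtype_coe hT)]
  refine (measure_mono (image_preimage_subset _ _)).trans_eq ?_
  rw [Kernel.prod_apply, Kernel.id_apply, Measure.prod_apply hT,
    lintegral_dirac' x (measurable_measure_prodMk_left hT)]

theorem Policy.ae_pairKernel_fst_eq [MeasurableSingletonClass X] (π : M.Policy) (i : ℕ) (x : X) :
    ∀ᵐ z ∂π.pairKernel i x, z.1.1 = x := by
  have h := π.pairKernel_preimage_le i x (T := {p | p.1 ≠ x})
    (measurable_fst (measurableSet_singleton x).compl)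
  have h' : Prod.mk x ⁻¹' {p : X × A | p.1 ≠ x} = ∅ := by
    ext a
    simp
  rw [h', measure_empty, nonpos_iff_eq_zero] at h
  exact h

theorem Policy.lintegral_pairKernel_fst [MeasurableSingletonClass X] (π : M.Policy) (i : ℕ)
    (x : X) (g : X → ℝ≥0∞) : ∫⁻ z, g z.1.1 ∂π.pairKernel i x = g x := by
  have : ∀ᵐ z ∂π.pairKernel i x, g z.1.1 = g x := by
    filter_upwards [π.ae_pairKernel_fst_eq i x] with z hz
    rw [hz]
  rw [lintegral_congr_ae this, lintegral_const, measure_univ, mul_one]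

instance (π : M.Policy) (x : X) : IsProbabilityMeasure (law π x) := by
  unfold law
  infer_instance

theorem lintegral_law_zero (π : M.Policy) (x : X) {h : M.Pairs → ℝ≥0∞} (hh : Measurable h) :
    ∫⁻ ω, h (ω 0) ∂law π x = ∫⁻ z, h z ∂π.pairKernel 0 x := by
  have hmap : (law π x).map (Preorder.frestrictLe 0) = (π.pairKernel 0 x).map
      (MeasurableEquiv.piUnique fun _ : Finset.Iic 0 => M.Pairs).symm := by
    rw [law, Kernel.trajMeasure, Measure.map_comp _ _ (by fun_prop), Kernel.traj_map_frestrictLe,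
      Kernel.partialTraj_self, Measure.id_comp]
  have hm : Measurable fun u : (Π _ : Finset.Iic 0, M.Pairs) =>
      h (u ⟨0, Finset.mem_Iic.2 le_rfl⟩) := hh.comp (measurable_pi_apply _)
  calc ∫⁻ ω, h (ω 0) ∂law π x
      = ∫⁻ u, h (u ⟨0, Finset.mem_Iic.2 le_rfl⟩) ∂(law π x).map (Preorder.frestrictLe 0) := by
        rw [lintegral_map hm (by fun_prop)]
        rfl
    _ = ∫⁻ z, h z ∂π.pairKernel 0 x := by
        rw [hmap, lintegral_map hm (by fun_prop)]
        rfl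

/-- The Markov property, tested against a weight `G` on the history. It is the Ionescu-Tulcea
disintegration of the law at time n + 1. -/
theorem lintegral_law_succ (π : M.Policy) (x : X) (n : ℕ)
    {G : (Π _ : Finset.Iic n, M.Pairs) → ℝ≥0∞} (hG : Measurable G)
    {h : M.Pairs → ℝ≥0∞} (hh : Measurable h) :
    ∫⁻ ω, G (Preorder.frestrictLe n ω) * h (ω (n + 1)) ∂law π x =
      ∫⁻ ω, G (Preorder.frestrictLe n ω) *
        ∫⁻ y, ∫⁻ z, h z ∂π.pairKernel (n + 1) y ∂M.Q (ω n) ∂law π x := by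
  have hmap := Kernel.map_frestrictLe_trajMeasure_compProd_eq_map_trajMeasure
    (X := fun _ => M.Pairs) (μ₀ := π.pairKernel 0 x) (κ := π.stepKernel) (a := n)
  change (law π x).map _ ⊗ₘ _ = (law π x).map _ at hmap
  have hm : Measurable fun p : (Π _ : Finset.Iic n, M.Pairs) × M.Pairs => G p.1 * h p.2 := by
    fun_prop
  have hinner : Measurable fun u : (Π _ : Finset.Iic n, M.Pairs) =>
      ∫⁻ z, G u * h z ∂π.stepKernel n u := by
    exact hm.lintegral_kernel_prod_right'
  calc ∫⁻ ω, G (Preorder.frestrictLe n ω) * h (ω (n + 1)) ∂law π x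
      = ∫⁻ p, G p.1 * h p.2 ∂(law π x).map
          (fun ω => (Preorder.frestrictLe n ω, ω (n + 1))) := by
        rw [lintegral_map hm (by fun_prop)]
    _ = ∫⁻ ω, ∫⁻ z, G (Preorder.frestrictLe n ω) * h z
          ∂π.stepKernel n (Preorder.frestrictLe n ω) ∂law π x := by
        rw [← hmap, Measure.lintegral_compProd hm, lintegral_map hinner (by fun_prop)]
    _ = _ := by
        refine lintegral_congr fun ω => ?_
        rw [lintegral_const_mul _ hh]
        congr 1
        rw [Policy.stepKernel, Kernel.comap_apply, Kernel.comp_apply,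
          Measure.lintegral_bind (Kernel.aemeasurable _) hh.aemeasurable]
        rfl

theorem ae_law_of_pairKernel (π : M.Policy) (x : X) {T : Set M.Pairs} (hT : MeasurableSet T)
    (h : ∀ i y, π.pairKernel i y Tᶜ = 0) : ∀ᵐ ω ∂law π x, ∀ i, ω i ∈ T := by
  rw [ae_all_iff]
  have hm : Measurable (Tᶜ.indicator (fun _ => (1 : ℝ≥0∞))) :=
    measurable_const.indicator hT.compl
  intro i
  have hzero : ∫⁻ ω, Tᶜ.indicator (fun _ => (1 : ℝ≥0∞)) (ω i) ∂law π x = 0 := by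
    cases i with
    | zero =>
      rw [lintegral_law_zero π x hm, lintegral_indicator_const hT.compl, h, mul_zero]
    | succ n =>
      have := lintegral_law_succ π x n (G := fun _ => 1) measurable_const hm
      simp only [one_mul] at this
      rw [this]
      simp only [lintegral_indicator_const hT.compl, h, mul_zero, lintegral_zero]
  filter_upwards [(lintegral_eq_zero_iff (hm.comp (measurable_pi_apply i))).1 hzero] with ω hω
  by_contra hn
  simp [hn] at hω

/-- The trajectories that do not visit `K` up to time `n`. -/
def avoids (M : MarkovControlModel X A) (K : Set X) (n : ℕ) : Set (ℕ → M.Pairs) :=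
  {ω | ∀ j ≤ n, (ω j).1.1 ∉ K}

variable {K : Set X}

theorem lt_hitTime_iff (ω : ℕ → M.Pairs) (n : ℕ) :
    (n : ℕ∞) < M.hitTime K ω ↔ ω ∈ M.avoids K n := by
  constructor
  · intro h j hj hjK
    have : M.hitTime K ω ≤ j := iInf₂_le j hjK
    exact absurd (h.trans_le this) (by simpa using hj)
  · intro h
    have : ((n + 1 : ℕ) : ℕ∞) ≤ M.hitTime K ω := by
      refine le_iInf₂ fun i hi => ?_
      by_contra hlt
      refine h i ?_ hi
      rw [not_le, Nat.cast_lt] at hlt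
      omega
    refine lt_of_lt_of_le ?_ this
    exact_mod_cast Nat.lt_succ_self n

theorem measurableSet_avoids (hK : MeasurableSet K) (n : ℕ) :
    MeasurableSet (M.avoids K n) := by
  have : M.avoids K n = ⋂ j, ⋂ (_ : j ≤ n), (fun ω : ℕ → M.Pairs => (ω j).1.1) ⁻¹' Kᶜ := by
    ext ω
    simp [avoids]
  rw [this]
  exact MeasurableSet.iInter fun j => MeasurableSet.iInter fun _ =>
    (show Measurable fun ω : ℕ → M.Pairs => (ω j).1.1 by fun_prop) hK.compl

/-- The expectation of `h (x_n, a_n)` on the event that `K` is not visited up to time `n`. -/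
noncomputable def killedExp (K : Set X) (π : M.Policy) (x : X) (h : M.Pairs → ℝ≥0∞) (n : ℕ) :
    ℝ≥0∞ :=
  ∫⁻ ω, (M.avoids K n).indicator (fun ω => h (ω n)) ω ∂law π x

theorem policyCost_eq_tsum (hK : MeasurableSet K) {α : ℝ} (hα : 0 ≤ α) (π : M.Policy) (x : X) :
    M.policyCost K α π x =
      ∑' n, ENNReal.ofReal α ^ n * killedExp K π x (fun z => ENNReal.ofReal (M.cost z)) n := by
  classical
  have hc : Measurable fun z => ENNReal.ofReal (M.cost z) := M.measurable_cost.ennreal_ofReal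
  have hind : ∀ n, Measurable ((M.avoids K n).indicator
      (fun ω : ℕ → M.Pairs => ENNReal.ofReal (M.cost (ω n)))) := fun n =>
    (hc.comp (measurable_pi_apply n)).indicator (measurableSet_avoids hK n)
  have hpt : ∀ (n : ℕ) (ω : ℕ → M.Pairs),
      (if (n : ℕ∞) < M.hitTime K ω then ENNReal.ofReal (α ^ n * M.cost (ω n)) else 0) =
      ENNReal.ofReal α ^ n * (M.avoids K n).indicator
        (fun ω : ℕ → M.Pairs => ENNReal.ofReal (M.cost (ω n))) ω := by
    intro n ω
    by_cases h : ω ∈ M.avoids K n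
    · rw [if_pos ((lt_hitTime_iff ω n).2 h), indicator_of_mem h,
        ENNReal.ofReal_mul (pow_nonneg hα n), ENNReal.ofReal_pow hα]
    · rw [if_neg (fun h' => h ((lt_hitTime_iff ω n).1 h')), indicator_of_notMem h, mul_zero]
  unfold policyCost
  have : ∀ ω : ℕ → M.Pairs, (∑' n : ℕ, (if (n : ℕ∞) < M.hitTime K ω then
      ENNReal.ofReal (α ^ n * M.cost (ω n)) else 0)) =
      ∑' n : ℕ, ENNReal.ofReal α ^ n * (M.avoids K n).indicator
        (fun ω : ℕ → M.Pairs => ENNReal.ofReal (M.cost (ω n))) ω :=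
    fun ω => tsum_congr fun n => hpt n ω
  calc _ = ∫⁻ ω, ∑' n : ℕ, ENNReal.ofReal α ^ n * (M.avoids K n).indicator
        (fun ω : ℕ → M.Pairs => ENNReal.ofReal (M.cost (ω n))) ω ∂law π x := by
        refine lintegral_congr fun ω => ?_
        rw [← this]
    _ = _ := by
        rw [lintegral_tsum fun n => ((hind n).const_mul _).aemeasurable]
        exact tsum_congr fun n => lintegral_const_mul _ (hind n)

theorem killedExp_zero_of_fst [MeasurableSingletonClass X] (π : M.Policy)
    (x : X) {g : X → ℝ≥0∞} (hg : Measurable g) (hgK : ∀ y ∈ K, g y = 0) :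
    killedExp K π x (fun z => g z.1.1) 0 = g x := by
  have h1 : ∀ ω : ℕ → M.Pairs, (M.avoids K 0).indicator
      (fun ω : ℕ → M.Pairs => g (ω 0).1.1) ω = g (ω 0).1.1 := by
    intro ω
    by_cases h : (ω 0).1.1 ∈ K
    · rw [hgK _ h, indicator_apply_eq_zero]
      exact fun _ => hgK _ h
    · exact indicator_of_mem (fun j hj => by rwa [Nat.le_zero.1 hj]) _
  unfold killedExp
  rw [lintegral_congr h1, lintegral_law_zero π x (h := fun z => g z.1.1) (by fun_prop),
    π.lintegral_pairKernel_fst]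

/-- Because `g` vanishes on `K`, avoidance need only be required up to time n. That event depends on
the history alone, so `lintegral_law_succ` applies. -/
theorem killedExp_succ_of_fst [MeasurableSingletonClass X] (hK : MeasurableSet K) (π : M.Policy)
    (x : X) {g : X → ℝ≥0∞} (hg : Measurable g) (hgK : ∀ y ∈ K, g y = 0) (n : ℕ) :
    killedExp K π x (fun z => g z.1.1) (n + 1) =
      killedExp K π x (fun z => ∫⁻ y, g y ∂M.Q z) n := by
  let H : Set (Π _ : Finset.Iic n, M.Pairs) := ⋂ j, (fun u => (u j).1.1) ⁻¹' Kᶜ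
  have hH : MeasurableSet H := MeasurableSet.iInter fun j =>
    (show Measurable fun u : (Π _ : Finset.Iic n, M.Pairs) => (u j).1.1 by fun_prop) hK.compl
  have hmem : ∀ ω : ℕ → M.Pairs, Preorder.frestrictLe n ω ∈ H ↔ ω ∈ M.avoids K n := by
    intro ω
    simp only [H, mem_iInter, mem_preimage, mem_compl_iff, avoids, mem_ofPred_eq]
    exact ⟨fun h j hj => h ⟨j, Finset.mem_Iic.2 hj⟩, fun h j => h j (Finset.mem_Iic.1 j.2)⟩
  have hstep := lintegral_law_succ π x n (G := H.indicator fun _ => 1)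
    (measurable_const.indicator hH) (h := fun z => g z.1.1) (by fun_prop)
  simp only [π.lintegral_pairKernel_fst] at hstep
  have h1 : ∀ ω : ℕ → M.Pairs, (M.avoids K (n + 1)).indicator
      (fun ω : ℕ → M.Pairs => g (ω (n + 1)).1.1) ω =
      H.indicator (fun _ => 1) (Preorder.frestrictLe n ω) * g (ω (n + 1)).1.1 := by
    intro ω
    by_cases hω : ω ∈ M.avoids K n
    · rw [indicator_of_mem ((hmem ω).2 hω), one_mul]
      by_cases h : (ω (n + 1)).1.1 ∈ K
      · rw [hgK _ h, indicator_apply_eq_zero]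
        exact fun _ => hgK _ h
      · refine indicator_of_mem (fun j hj => ?_) _
        rcases Nat.le_succ_iff.1 hj with hj | rfl
        exacts [hω j hj, h]
    · rw [indicator_of_notMem fun h => hω ((hmem ω).1 h), zero_mul]
      exact indicator_of_notMem (fun h : ω ∈ M.avoids K (n + 1) =>
        hω fun j hj => h j (hj.trans n.le_succ)) _
  have h2 : ∀ ω : ℕ → M.Pairs, (M.avoids K n).indicator
      (fun ω : ℕ → M.Pairs => ∫⁻ y, g y ∂M.Q (ω n)) ω =
      H.indicator (fun _ => 1) (Preorder.frestrictLe n ω) * ∫⁻ y, g y ∂M.Q (ω n) := by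
    intro ω
    by_cases hω : ω ∈ M.avoids K n
    · rw [indicator_of_mem ((hmem ω).2 hω), one_mul, indicator_of_mem hω]
    · rw [indicator_of_notMem fun h => hω ((hmem ω).1 h), zero_mul, indicator_of_notMem hω]
  unfold killedExp
  rw [lintegral_congr h1, lintegral_congr h2, hstep]

theorem killedExp_le_of_le (π : M.Policy) (x : X) {h : M.Pairs → ℝ≥0∞} {b : ℝ≥0∞}
    (hb : ∀ z, h z ≤ b) (n : ℕ) : killedExp K π x h n ≤ b := by
  unfold killedExp
  calc _ ≤ ∫⁻ _, b ∂law π x :=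
        lintegral_mono fun ω => (indicator_le_self _ _ ω).trans (hb _)
    _ = b := by simp

theorem killedExp_add_mul (hK : MeasurableSet K) (π : M.Policy) (x : X) {h k : M.Pairs → ℝ≥0∞}
    (hh : Measurable h) (hk : Measurable k) (a : ℝ≥0∞) (n : ℕ) :
    killedExp K π x (fun z => h z + a * k z) n =
      killedExp K π x h n + a * killedExp K π x k n := by
  have hmeas : ∀ {h : M.Pairs → ℝ≥0∞}, Measurable h →
      Measurable ((M.avoids K n).indicator fun ω : ℕ → M.Pairs => h (ω n)) := fun hh =>
    (hh.comp (measurable_pi_apply n)).indicator (measurableSet_avoids hK n)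
  unfold killedExp
  rw [← lintegral_const_mul a (hmeas hk), ← lintegral_add_left (hmeas hh)]
  refine lintegral_congr fun ω => ?_
  by_cases hω : ω ∈ M.avoids K n
  · simp only [indicator_of_mem hω]
  · simp only [indicator_of_notMem hω, mul_zero, add_zero]

end MarkovControlModel

/-! ### Monotonicity and contraction of the Bellman operator -/

namespace MarkovControlModel

section ExtendZero

variable {X : Type*} {K : Set X} {ξ : ↥Kᶜ → ℝ≥0∞}

/-- The extension by zero of a function on the complement of `K`. -/
noncomputable def extendZero (ξ : ↥Kᶜ → ℝ≥0∞) : X → ℝ≥0∞ :=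
  Function.extend Subtype.val ξ fun _ => 0

theorem extendZero_coe (ξ : ↥Kᶜ → ℝ≥0∞) (x : ↥Kᶜ) : extendZero ξ x = ξ x :=
  Subtype.val_injective.extend_apply _ _ _

theorem extendZero_of_mem (ξ : ↥Kᶜ → ℝ≥0∞) {x : X} (hx : x ∈ K) : extendZero ξ x = 0 :=
  Function.extend_apply' _ _ _ (by rintro ⟨y, rfl⟩; exact y.2 hx)

theorem extendZero_le {b : ℝ≥0∞} (h : ∀ x, ξ x ≤ b) (x : X) : extendZero ξ x ≤ b := by
  by_cases hx : x ∈ K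
  · rw [extendZero_of_mem ξ hx]
    exact zero_le
  · exact (extendZero_coe ξ ⟨x, hx⟩).trans_le (h _)

end ExtendZero

section Bellman

variable {X A : Type*} [MeasurableSpace X] [MeasurableSpace A] {M : MarkovControlModel X A}
  {K : Set X} {α : ℝ} {ξ η : ↥Kᶜ → ℝ≥0∞}

theorem measurable_extendZero (hK : MeasurableSet K) (hξ : Measurable ξ) :
    Measurable (extendZero ξ) :=
  (MeasurableEmbedding.subtype_coe hK.compl).measurable_extend hξ measurable_const

theorem lintegral_comap_eq_extendZero (hK : MeasurableSet K) (ξ : ↥Kᶜ → ℝ≥0∞) (μ : Measure X) :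
    ∫⁻ y : ↥Kᶜ, ξ y ∂μ.comap Subtype.val = ∫⁻ y, extendZero ξ y ∂μ := by
  have h := lintegral_subtype_comap (μ := μ) hK.compl (extendZero ξ)
  simp only [extendZero_coe] at h
  rw [h, ← lintegral_indicator hK.compl]
  congr 1
  rw [indicator_eq_self]
  intro y hy hyK
  exact hy (extendZero_of_mem ξ hyK)

theorem bellmanTerm_eq (hK : MeasurableSet K) (ξ : ↥Kᶜ → ℝ≥0∞) (z : M.Pairs) :
    M.bellmanTerm K α ξ z = ENNReal.ofReal (M.cost z) +
      ENNReal.ofReal α * ∫⁻ y, extendZero ξ y ∂M.Q z := by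
  rw [bellmanTerm, lintegral_comap_eq_extendZero hK]

theorem measurable_bellmanTerm (hK : MeasurableSet K) (hξ : Measurable ξ) :
    Measurable (M.bellmanTerm K α ξ) := by
  have : M.bellmanTerm K α ξ = fun z => ENNReal.ofReal (M.cost z) +
      ENNReal.ofReal α * ∫⁻ y, extendZero ξ y ∂M.Q z := funext (bellmanTerm_eq hK ξ)
  rw [this]
  exact M.measurable_cost.ennreal_ofReal.add
    ((measurable_extendZero hK hξ).lintegral_kernel.const_mul _)

/-- Q has total mass 1, so an error e contributes at most αe. The one-sided additive form of the
contraction avoids subtraction in [0, ∞]. -/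
theorem bellmanTerm_le_add (hK : MeasurableSet K) (hη : Measurable η) {e : ℝ≥0∞}
    (h : ∀ x, ξ x ≤ η x + e) (z : M.Pairs) :
    M.bellmanTerm K α ξ z ≤ M.bellmanTerm K α η z + ENNReal.ofReal α * e := by
  rw [bellmanTerm_eq hK, bellmanTerm_eq hK, add_assoc, ← mul_add]
  gcongr
  calc ∫⁻ y, extendZero ξ y ∂M.Q z ≤ ∫⁻ y, (extendZero η y + e) ∂M.Q z := by
        refine lintegral_mono fun y => ?_
        by_cases hy : y ∈ K
        · rw [extendZero_of_mem ξ hy]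
          exact zero_le
        · have := h ⟨y, hy⟩
          rwa [← extendZero_coe ξ, ← extendZero_coe η] at this
    _ = ∫⁻ y, extendZero η y ∂M.Q z + e := by
        rw [lintegral_add_left (measurable_extendZero hK hη)]
        simp

theorem sInf_bellmanValues_le (ξ : ↥Kᶜ → ℝ≥0∞) (x : ↥Kᶜ) {a : A} (ha : a ∈ M.feas x) :
    sInf (M.bellmanValues K α ξ x) ≤ M.bellmanTerm K α ξ ⟨(x, a), ha⟩ :=
  sInf_le (mem_image_of_mem _ (show (x : X) = x from rfl))

theorem sInf_bellmanValues_le_add (hK : MeasurableSet K) (hη : Measurable η) {e : ℝ≥0∞}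
    (h : ∀ x, ξ x ≤ η x + e) (x : ↥Kᶜ) :
    sInf (M.bellmanValues K α ξ x) ≤
      sInf (M.bellmanValues K α η x) + ENNReal.ofReal α * e := by
  rw [← tsub_le_iff_right]
  refine le_sInf ?_
  rintro _ ⟨z, hz, rfl⟩
  rw [tsub_le_iff_right]
  exact (sInf_le (mem_image_of_mem _ hz)).trans (bellmanTerm_le_add hK hη h z)

theorem sInf_bellmanValues_mono (hK : MeasurableSet K) (hη : Measurable η) (h : ξ ≤ η)
    (x : ↥Kᶜ) : sInf (M.bellmanValues K α ξ x) ≤ sInf (M.bellmanValues K α η x) := by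
  simpa using sInf_bellmanValues_le_add (M := M) (α := α) hK hη (e := 0)
    (fun y => (h y).trans (add_zero _).ge) x

theorem valueIter_le_add (hK : MeasurableSet K) {b : ℝ≥0∞}
    (hm : ∀ n, Measurable (M.valueIter K α n)) (hb : ∀ n x, M.valueIter K α n x ≤ b) (n m : ℕ)
    (x : ↥Kᶜ) : M.valueIter K α m x ≤ M.valueIter K α n x + ENNReal.ofReal α ^ n * b := by
  induction n generalizing m x with
  | zero => simpa [valueIter] using hb m x
  | succ n ih =>
    cases m with
    | zero => exact zero_le
    | succ m =>
      rw [pow_succ', mul_assoc]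
      exact sInf_bellmanValues_le_add hK (hm n) (ih m) x

end Bellman

/-! ### Comparing solutions with policy costs -/

section Verification

variable {X A : Type*} [MeasurableSpace X] [MeasurableSpace A] {M : MarkovControlModel X A}
  {K : Set X} {α : ℝ} {ξ : ↥Kᶜ → ℝ≥0∞}

/-- A bounded subsolution of the optimality equation is a lower bound for the cost of every
policy. -/
theorem le_policyCost_of_le_bellmanTerm [MeasurableSingletonClass X] (hK : MeasurableSet K)
    (hα : α ∈ Ioo (0 : ℝ) 1) (hξ : Measurable ξ) {b : ℝ≥0∞} (hb : b ≠ ∞) (hξb : ∀ x, ξ x ≤ b)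
    (h : ∀ z ∈ M.pairsOff K, extendZero ξ z.1.1 ≤ M.bellmanTerm K α ξ z) (π : M.Policy)
    (x : ↥Kᶜ) : ξ x ≤ M.policyCost K α π x := by
  have hg := measurable_extendZero hK hξ
  have hgK : ∀ y ∈ K, extendZero ξ y = 0 := fun y => extendZero_of_mem ξ
  have hc : Measurable fun z => ENNReal.ofReal (M.cost z) := M.measurable_cost.ennreal_ofReal
  let c : ℕ → ℝ≥0∞ := killedExp K π x fun z => ENNReal.ofReal (M.cost z)
  let m : ℕ → ℝ≥0∞ := killedExp K π x fun z => extendZero ξ z.1.1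
  have hstep : ∀ n, m n ≤ c n + ENNReal.ofReal α * m (n + 1) := by
    intro n
    simp only [m, c]
    rw [killedExp_succ_of_fst hK π x hg hgK,
      ← killedExp_add_mul hK π x hc hg.lintegral_kernel]
    refine lintegral_mono fun ω => indicator_le_indicator' fun hω => ?_
    beta_reduce
    rw [← bellmanTerm_eq hK]
    exact h _ (hω n le_rfl)
  -- Iterating the one-step inequality leaves a remainder αⁿ `m n`, at most αⁿb, which tends to 0
  -- since b is finite.
  have hsum : ∀ n, m 0 ≤ ∑ i ∈ Finset.range n, ENNReal.ofReal α ^ i * c i +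
      ENNReal.ofReal α ^ n * m n := by
    intro n
    induction n with
    | zero => simp
    | succ n ih =>
      refine ih.trans ?_
      rw [Finset.sum_range_succ, pow_succ, add_assoc, mul_assoc, ← mul_add]
      gcongr
      exact hstep n
  have hm0 : m 0 = ξ x := by
    simp only [m]
    rw [killedExp_zero_of_fst π x hg hgK, extendZero_coe]
  have hbound : ∀ n, ξ x ≤ M.policyCost K α π x + ENNReal.ofReal α ^ n * b := by
    intro n
    rw [← hm0, policyCost_eq_tsum hK hα.1.le]
    refine (hsum n).trans (add_le_add (ENNReal.sum_le_tsum _) ?_)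
    gcongr
    exact killedExp_le_of_le π x (fun z => extendZero_le hξb _) n
  have hlim : Filter.Tendsto (fun n : ℕ => M.policyCost K α π x + ENNReal.ofReal α ^ n * b)
      Filter.atTop (nhds (M.policyCost K α π x + 0 * b)) := by
    refine tendsto_const_nhds.add (ENNReal.Tendsto.mul_const
      (ENNReal.tendsto_pow_atTop_nhds_zero_of_lt_one ?_) (Or.inr hb))
    exact ENNReal.ofReal_lt_one.2 hα.2
  rw [zero_mul, add_zero] at hlim
  exact ge_of_tendsto' hlim hbound

/-- If the policy `π` almost surely uses actions at which the Bellman term of `ξ` is at most `ξ`,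
then its cost is at most `ξ`. -/
theorem policyCost_le_of_bellmanTerm_le [MeasurableSingletonClass X] (hK : MeasurableSet K)
    (hα : α ∈ Ioo (0 : ℝ) 1) (hξ : Measurable ξ) (π : M.Policy) (x : ↥Kᶜ)
    (h : ∀ᵐ ω ∂law π (x : X), ∀ n, ω n ∈ M.pairsOff K →
      M.bellmanTerm K α ξ (ω n) ≤ extendZero ξ (ω n).1.1) :
    M.policyCost K α π x ≤ ξ x := by
  have hg := measurable_extendZero hK hξ
  have hgK : ∀ y ∈ K, extendZero ξ y = 0 := fun y => extendZero_of_mem ξ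
  have hc : Measurable fun z => ENNReal.ofReal (M.cost z) := M.measurable_cost.ennreal_ofReal
  let c : ℕ → ℝ≥0∞ := killedExp K π x fun z => ENNReal.ofReal (M.cost z)
  let m : ℕ → ℝ≥0∞ := killedExp K π x fun z => extendZero ξ z.1.1
  have hstep : ∀ n, c n + ENNReal.ofReal α * m (n + 1) ≤ m n := by
    intro n
    simp only [m, c]
    rw [killedExp_succ_of_fst hK π x hg hgK,
      ← killedExp_add_mul hK π x hc hg.lintegral_kernel]
    refine lintegral_mono_ae ?_
    filter_upwards [h] with ω hω
    refine indicator_le_indicator' fun hωK => ?_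
    rw [← bellmanTerm_eq hK]
    exact hω n (hωK n le_rfl)
  have hsum : ∀ n, ∑ i ∈ Finset.range n, ENNReal.ofReal α ^ i * c i +
      ENNReal.ofReal α ^ n * m n ≤ m 0 := by
    intro n
    induction n with
    | zero => simp
    | succ n ih =>
      refine le_trans ?_ ih
      rw [Finset.sum_range_succ, pow_succ, add_assoc, mul_assoc, ← mul_add]
      gcongr
      exact hstep n
  have hm0 : m 0 = ξ x := by
    simp only [m]
    rw [killedExp_zero_of_fst π x hg hgK, extendZero_coe]
  rw [← hm0, policyCost_eq_tsum hK hα.1.le]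
  -- In this direction the nonnegative remainder is simply dropped.
  exact ENNReal.tsum_le_of_sum_range_le fun n => le_self_add.trans (hsum n)

/-- The deterministic stationary policy given by a measurable selector. -/
noncomputable def stationaryPolicy (f : X → A) (hf : Measurable f) (hfeas : ∀ x, f x ∈ M.feas x) :
    M.Policy where
  φ _ := Kernel.deterministic f hf
  isMarkovKernel_φ _ := inferInstance
  φ_feas _ x := by
    rw [Kernel.deterministic_apply' _ _ (M.measurableSet_feas x), indicator_of_mem (hfeas x)]

theorem ae_law_stationaryPolicy [MeasurableEq A] (f : X → A)
    (hf : Measurable f) (hfeas : ∀ x, f x ∈ M.feas x) (x : X) :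
    ∀ᵐ ω ∂law (stationaryPolicy f hf hfeas) x, ∀ n, (ω n).1.2 = f (ω n).1.1 := by
  have hT : MeasurableSet {p : X × A | p.2 = f p.1} :=
    measurableSet_eq_fun measurable_snd (hf.comp measurable_fst)
  refine ae_law_of_pairKernel _ x (measurable_subtype_coe hT) fun i y => ?_
  have := (stationaryPolicy f hf hfeas).pairKernel_preimage_le i y hT.compl
  rw [← preimage_compl]
  refine le_antisymm (this.trans_eq ?_) zero_le
  rw [stationaryPolicy, Kernel.deterministic_apply' _ _ (measurable_prodMk_left hT.compl)]
  exact indicator_of_notMem (by simp) _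

end Verification

/-! ### Lower semicontinuity of the Bellman term -/

section Semicontinuity

variable {X A : Type*} [TopologicalSpace X] [MeasurableSpace X] [TopologicalSpace A]
  [MeasurableSpace A] {M : MarkovControlModel X A} {K : Set X} {α : ℝ} {ξ : ↥Kᶜ → ℝ≥0∞}

theorem lowerSemicontinuousOn_bellmanTerm (hK : MeasurableSet K) (hM : M.Regular K)
    (hξ : Measurable ξ) {b : ℝ≥0∞} (hb : b ≠ ∞) (hξb : ∀ x, ξ x ≤ b) :
    LowerSemicontinuousOn (M.bellmanTerm K α ξ) (M.pairsOff K) := by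
  have hg := measurable_extendZero hK hξ
  have hgb : ∀ y, extendZero ξ y ≤ b := extendZero_le hξb
  have hcont : ContinuousOn (fun z => ∫⁻ y, extendZero ξ y ∂M.Q z) (M.pairsOff K) := by
    -- The strong Feller condition concerns real integrals; boundedness by a finite b lets it
    -- transfer to the `lintegral`.
    have hF := hM.strongFeller (fun y => (extendZero ξ y).toReal) hg.ennreal_toReal
      ⟨b.toReal, fun y => by
        rw [abs_of_nonneg ENNReal.toReal_nonneg]
        exact ENNReal.toReal_mono hb (hgb y)⟩
    refine (ENNReal.continuous_ofReal.comp_continuousOn hF).congr fun z _ => ?_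
    rw [Function.comp_apply, integral_toReal hg.aemeasurable
      (Filter.Eventually.of_forall fun y => (hgb y).trans_lt hb.lt_top), ENNReal.ofReal_toReal]
    refine ((lintegral_mono hgb).trans_lt ?_).ne
    simpa using hb.lt_top
  have : M.bellmanTerm K α ξ = fun z => ENNReal.ofReal (M.cost z) +
      ENNReal.ofReal α * ∫⁻ y, extendZero ξ y ∂M.Q z := funext (bellmanTerm_eq hK ξ)
  rw [this]
  refine LowerSemicontinuousOn.add
    (ENNReal.continuous_ofReal.comp_lowerSemicontinuousOn hM.cost_lsc fun _ _ h =>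
      ENNReal.ofReal_le_ofReal h) ?_
  exact ((ENNReal.continuous_const_mul ENNReal.ofReal_ne_top).comp_continuousOn
    hcont).lowerSemicontinuousOn

end Semicontinuity

/-! ### Measurable minimizers and the optimality equation -/

section Optimality

variable {X A : Type*}
  [TopologicalSpace X] [MeasurableSpace X] [StandardBorelSpace X]
  [TopologicalSpace A] [TopologicalSpace.MetrizableSpace A] [SecondCountableTopology A]
  [MeasurableSpace A] [BorelSpace A] [StandardBorelSpace A]
  {M : MarkovControlModel X A} {K : Set X} {α : ℝ} {ξ : ↥Kᶜ → ℝ≥0∞}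

/-- The minimum in the Bellman operator is attained by a measurable selector. -/
theorem exists_measurable_minimizer (hK : MeasurableSet K) (hM : M.Regular K)
    (hξ : Measurable ξ) {b : ℝ≥0∞} (hb : b ≠ ∞) (hξb : ∀ x, ξ x ≤ b) :
    ∃ (f : X → A) (_ : Measurable f) (hfeas : ∀ x, f x ∈ M.feas x), ∀ x : ↥Kᶜ,
      IsLeast (M.bellmanValues K α ξ x) (M.bellmanTerm K α ξ ⟨(x, f x), hfeas x⟩) := by
  have : StandardBorelSpace ↥Kᶜ := hK.compl.standardBorel
  let D : Set (↥Kᶜ × A) := Prod.map Subtype.val id ⁻¹' {p : X × A | p.2 ∈ M.feas p.1}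
  have hmap : Measurable (Prod.map Subtype.val id : ↥Kᶜ × A → X × A) :=
    measurable_subtype_coe.prodMap measurable_id
  have hD : MeasurableSet D := hmap M.measurableSet_graph
  let F : ↥Kᶜ × A → ℝ≥0∞ := Function.extend Subtype.val (M.bellmanTerm K α ξ) (fun _ => 0) ∘
    Prod.map Subtype.val id
  have hF : Measurable F :=
    ((MeasurableEmbedding.subtype_coe M.measurableSet_graph).measurable_extend
      (measurable_bellmanTerm hK hξ) measurable_const).comp hmap
  have hFz : ∀ (x : ↥Kᶜ) (a : A) (h : a ∈ M.feas x),
      F (x, a) = M.bellmanTerm K α ξ ⟨(x, a), h⟩ := fun x a h =>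
    Subtype.val_injective.extend_apply (M.bellmanTerm K α ξ) (fun _ => 0)
      (⟨((x : X), a), h⟩ : M.Pairs)
  have hl : ∀ x, LowerSemicontinuousOn (fun a => F (x, a)) {a | (x, a) ∈ D} := by
    intro x
    rw [← lowerSemicontinuous_restrict_iff]
    have hcont : Continuous fun a : {a | (x, a) ∈ D} => (⟨((x : X), a.1), a.2⟩ : M.Pairs) := by
      fun_prop
    have hcomp := (lowerSemicontinuousOn_bellmanTerm (α := α) hK hM hξ hb hξb).comp
      hcont.continuousOn (t := univ) fun a _ => x.2
    rw [lowerSemicontinuousOn_univ_iff] at hcomp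
    convert! hcomp using 1
    funext a
    exact hFz x a.1 a.2
  obtain ⟨f, hf, hfmin⟩ := exists_measurable_argmin hD (fun x => M.feas_nonempty x)
    (fun x => hM.isCompact_feas x) hF hl
  -- The minimizer is defined only off `K`; a policy also needs feasible actions on `K`.
  obtain ⟨f₀, hf₀, hf₀feas⟩ := hM.exists_selector
  have hext : ∀ x : ↥Kᶜ, Function.extend Subtype.val f f₀ (x : X) = f x := fun x =>
    Subtype.val_injective.extend_apply _ _ _
  have hfeas : ∀ x, Function.extend Subtype.val f f₀ x ∈ M.feas x := by
    intro x
    by_cases hx : x ∈ K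
    · rw [Function.extend_apply' _ _ _ (by rintro ⟨y, rfl⟩; exact y.2 hx)]
      exact hf₀feas x
    · rw [hext ⟨x, hx⟩]
      exact (hfmin ⟨x, hx⟩).1
  refine ⟨Function.extend Subtype.val f f₀,
    (MeasurableEmbedding.subtype_coe hK.compl).measurable_extend hf hf₀, hfeas, fun x => ?_⟩
  refine ⟨⟨_, rfl, rfl⟩, ?_⟩
  rintro _ ⟨⟨⟨y, a⟩, ha⟩, hy, rfl⟩
  obtain rfl : y = x := hy
  rw [← hFz x a ha, ← hFz x _ (hfeas x), hext]
  exact (hfmin x).2 a ha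

theorem isLeast_sInf_bellmanValues (hK : MeasurableSet K) (hM : M.Regular K)
    (hξ : Measurable ξ) {b : ℝ≥0∞} (hb : b ≠ ∞) (hξb : ∀ x, ξ x ≤ b) (x : ↥Kᶜ) :
    IsLeast (M.bellmanValues K α ξ x) (sInf (M.bellmanValues K α ξ x)) := by
  obtain ⟨f, -, hfeas, h⟩ := exists_measurable_minimizer (α := α) hK hM hξ hb hξb
  rw [(h x).csInf_eq]
  exact h x

theorem measurable_sInf_bellmanValues (hK : MeasurableSet K) (hM : M.Regular K)
    (hξ : Measurable ξ) {b : ℝ≥0∞} (hb : b ≠ ∞) (hξb : ∀ x, ξ x ≤ b) :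
    Measurable fun x => sInf (M.bellmanValues K α ξ x) := by
  obtain ⟨f, hf, hfeas, h⟩ := exists_measurable_minimizer (α := α) hK hM hξ hb hξb
  simp only [fun x => (h x).csInf_eq]
  refine (measurable_bellmanTerm hK hξ).comp (Measurable.subtype_mk ?_)
  exact measurable_subtype_coe.prodMk (hf.comp measurable_subtype_coe)

/-- A bounded measurable solution of the optimality equation is the value function. -/
theorem SolvesDCOE.eq_valueFun (hK : MeasurableSet K) (hα : α ∈ Ioo (0 : ℝ) 1)
    (hM : M.Regular K) (hξ : Measurable ξ) {b : ℝ≥0∞} (hb : b ≠ ∞) (hξb : ∀ x, ξ x ≤ b)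
    (h : M.SolvesDCOE K α ξ) : ξ = M.valueFun K α := by
  funext x
  refine le_antisymm (le_iInf fun π => ?_) ?_
  · refine le_policyCost_of_le_bellmanTerm hK hα hξ hb hξb (fun z hz => ?_) π x
    rw [extendZero_coe ξ ⟨z.1.1, hz⟩]
    exact (h ⟨z.1.1, hz⟩).2 ⟨z, rfl, rfl⟩
  · obtain ⟨f, hf, hfeas, hmin⟩ := exists_measurable_minimizer (α := α) hK hM hξ hb hξb
    refine (iInf_le _ (stationaryPolicy f hf hfeas)).trans
      (policyCost_le_of_bellmanTerm_le hK hα hξ _ x ?_)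
    filter_upwards [ae_law_stationaryPolicy f hf hfeas (x : X)] with ω hω n hn
    rw [extendZero_coe ξ ⟨(ω n).1.1, hn⟩, (h ⟨(ω n).1.1, hn⟩).unique (hmin ⟨(ω n).1.1, hn⟩)]
    refine le_of_eq (congrArg _ (Subtype.ext (Prod.ext rfl (hω n))))

/-- The value iterates are measurable and bounded by any bound that the Bellman operator
preserves. -/
theorem measurable_valueIter_and_le (hK : MeasurableSet K) (hM : M.Regular K) {b c : ℝ≥0∞}
    (hb : b ≠ ∞) (hc : ∀ z ∈ M.pairsOff K, ENNReal.ofReal (M.cost z) ≤ c)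
    (hcb : c + ENNReal.ofReal α * b ≤ b) (n : ℕ) :
    Measurable (M.valueIter K α n) ∧ ∀ x, M.valueIter K α n x ≤ b := by
  induction n with
  | zero => exact ⟨measurable_const, fun x => zero_le⟩
  | succ n ih =>
    refine ⟨measurable_sInf_bellmanValues hK hM ih.1 hb ih.2, fun x => ?_⟩
    obtain ⟨a, ha⟩ := M.feas_nonempty x
    refine (sInf_bellmanValues_le _ x ha).trans (le_trans ?_ hcb)
    rw [bellmanTerm_eq hK]
    refine add_le_add (hc _ x.2) (mul_le_mul_right ?_ _)
    calc _ ≤ ∫⁻ _, b ∂M.Q ⟨(x, a), ha⟩ := lintegral_mono (extendZero_le ih.2)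
      _ = b := by simp

/-- For w = sup v_n, monotonicity gives w ≤ Tw. Conversely w ≤ v_n + αⁿb gives Tw ≤ v_{n+1} + αⁿ⁺¹b
≤ w + αⁿ⁺¹b; let n → ∞. -/
theorem solvesDCOE_iSup_valueIter (hK : MeasurableSet K) (hα : α ∈ Ioo (0 : ℝ) 1)
    (hM : M.Regular K) {b : ℝ≥0∞} (hb : b ≠ ∞)
    (hm : ∀ n, Measurable (M.valueIter K α n)) (hvb : ∀ n x, M.valueIter K α n x ≤ b) :
    M.SolvesDCOE K α fun x => ⨆ n, M.valueIter K α n x := by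
  intro x
  let w : ↥Kᶜ → ℝ≥0∞ := fun x => ⨆ n, M.valueIter K α n x
  have hw : Measurable w := Measurable.iSup hm
  have hwb : ∀ x, w x ≤ b := fun x => iSup_le fun n => hvb n x
  have hfix : sInf (M.bellmanValues K α w x) = w x := by
    refine le_antisymm ?_ (iSup_le fun n => ?_)
    · have hle : ∀ n, sInf (M.bellmanValues K α w x) ≤ w x + ENNReal.ofReal α ^ (n + 1) * b := by
        intro n
        have h := sInf_bellmanValues_le_add (M := M) (α := α) (ξ := w) hK (hm n)
          (fun y => iSup_le fun m => valueIter_le_add hK hm hvb n m y) x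
        rw [pow_succ', mul_assoc]
        refine h.trans (add_le_add_left ?_ _)
        exact le_iSup (fun k => M.valueIter K α k x) (n + 1)
      have hlim : Filter.Tendsto (fun n : ℕ => w x + ENNReal.ofReal α ^ (n + 1) * b)
          Filter.atTop (nhds (w x + 0 * b)) := by
        refine tendsto_const_nhds.add (ENNReal.Tendsto.mul_const
          ((ENNReal.tendsto_pow_atTop_nhds_zero_of_lt_one ?_).comp
            (Filter.tendsto_add_atTop_nat 1)) (Or.inr hb))
        exact ENNReal.ofReal_lt_one.2 hα.2
      rw [zero_mul, add_zero] at hlim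
      exact ge_of_tendsto' hlim hle
    · cases n with
      | zero => exact zero_le
      | succ n =>
        exact sInf_bellmanValues_mono hK hw (fun y => le_iSup (fun k => M.valueIter K α k y) n) x
  have hleast := isLeast_sInf_bellmanValues (α := α) hK hM hw hb hwb x
  rw [hfix] at hleast
  exact hleast

end Optimality

end MarkovControlModel

/-! ### Assembly of the main theorem -/

theorem corollary4p4
    {X A : Type*}
    [TopologicalSpace X] [TopologicalSpace.MetrizableSpace X] [SecondCountableTopology X]
    [MeasurableSpace X] [BorelSpace X] [StandardBorelSpace X] [Nonempty X]
    [TopologicalSpace A] [TopologicalSpace.MetrizableSpace A] [SecondCountableTopology A]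
    [MeasurableSpace A] [BorelSpace A] [StandardBorelSpace A] [Nonempty A]
    (M : MarkovControlModel X A) (K : Set X) (hK : MeasurableSet K)
    (α : ℝ) (hα : α ∈ Ioo (0 : ℝ) 1)
    (hM : M.Regular K)
    (hbdd : BddAbove (M.cost '' M.pairsOff K))
    (C : ℝ) (hC : C = sSup (M.cost '' M.pairsOff K)) :
    -- (i)
    supNorm (M.valueFun K α) ≤ ENNReal.ofReal (C / (1 - α)) ∧
    -- (ii), including that the minima that define the iterates are attained
    (∀ n : ℕ, Measurable (M.valueIter K α n) ∧
      ∀ x, IsLeast (M.bellmanValues K α (M.valueIter K α n) x) (M.valueIter K α (n + 1) x)) ∧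
    (∀ (n : ℕ) (x : ↥Kᶜ),
      M.valueFun K α x ≤ M.valueIter K α n x + ENNReal.ofReal (C * (α ^ n / (1 - α)))) ∧
    (∀ n : ℕ,
      supDist (M.valueIter K α n) (M.valueFun K α) ≤ ENNReal.ofReal (C * α ^ n / (1 - α))) ∧
    -- (iii)
    (∀ ξ : ↥Kᶜ → ℝ≥0∞,
      (Measurable ξ ∧ supNorm ξ < ∞ ∧ M.SolvesDCOE K α ξ) ↔ ξ = M.valueFun K α) := by
  have h1α : 0 < 1 - α := sub_pos.2 hα.2
  have hC0 : 0 ≤ C := by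
    rw [hC]
    -- This includes the case of no pairs off `K`, where the real `sSup` of ∅ is 0.
    refine Real.sSup_nonneg ?_
    rintro _ ⟨z, hz, rfl⟩
    exact hM.cost_nonneg z hz
  set b : ℝ≥0∞ := ENNReal.ofReal (C / (1 - α)) with hbdef
  have hb : b ≠ ∞ := ENNReal.ofReal_ne_top
  have hcost : ∀ z ∈ M.pairsOff K, ENNReal.ofReal (M.cost z) ≤ ENNReal.ofReal C := fun z hz =>
    ENNReal.ofReal_le_ofReal (hC ▸ le_csSup hbdd (mem_image_of_mem _ hz))
  have hcb : ENNReal.ofReal C + ENNReal.ofReal α * b ≤ b := by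
    rw [hbdef, ← ENNReal.ofReal_mul hα.1.le, ← ENNReal.ofReal_add hC0
      (mul_nonneg hα.1.le (div_nonneg hC0 h1α.le))]
    refine ENNReal.ofReal_le_ofReal (le_of_eq ?_)
    field_simp
    ring
  have hv := MarkovControlModel.measurable_valueIter_and_le (α := α) hK hM hb hcost hcb
  have hvm := fun n => (hv n).1
  have hvb := fun n => (hv n).2
  have hsol := MarkovControlModel.solvesDCOE_iSup_valueIter hK hα hM hb hvm hvb
  have hwm : Measurable fun x => ⨆ n, M.valueIter K α n x := Measurable.iSup hvm
  have hV : (fun x => ⨆ n, M.valueIter K α n x) = M.valueFun K α :=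
    hsol.eq_valueFun hK hα hM hwm hb fun x => iSup_le fun n => hvb n x
  have hVx : ∀ x, M.valueFun K α x = ⨆ n, M.valueIter K α n x := fun x => (congrFun hV x).symm
  have hVb : supNorm (M.valueFun K α) ≤ b := iSup_le fun x => by
    rw [hVx]
    exact iSup_le fun n => hvb n x
  have hpow : ∀ n : ℕ, ENNReal.ofReal α ^ n * b = ENNReal.ofReal (C * α ^ n / (1 - α)) := by
    intro n
    rw [hbdef, ← ENNReal.ofReal_pow hα.1.le, ← ENNReal.ofReal_mul (pow_nonneg hα.1.le n)]
    congr 1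
    ring
  have hupper : ∀ (n : ℕ) (x : ↥Kᶜ),
      M.valueFun K α x ≤ M.valueIter K α n x + ENNReal.ofReal (C * α ^ n / (1 - α)) := by
    intro n x
    rw [hVx, ← hpow]
    exact iSup_le fun m => MarkovControlModel.valueIter_le_add hK hvm hvb n m x
  refine ⟨hVb, fun n => ⟨hvm n, fun x =>
    MarkovControlModel.isLeast_sInf_bellmanValues hK hM (hvm n) hb (hvb n) x⟩,
    fun n x => ?_, fun n => iSup_le fun x => max_le ?_ ?_, fun ξ => ⟨?_, ?_⟩⟩
  · rw [← mul_div_assoc]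
    exact hupper n x
  -- As V⋆ is the supremum of the iterates, v_n ≤ V⋆ and this truncated difference is 0.
  · rw [tsub_eq_zero_of_le]
    · exact zero_le
    · rw [hVx]
      exact le_iSup (fun k => M.valueIter K α k x) n
  · rw [tsub_le_iff_left]
    exact hupper n x
  · rintro ⟨hξ, hξb, hξs⟩
    exact hξs.eq_valueFun hK hα hM hξ hξb.ne fun x => le_iSup ξ x
  · rintro rfl
    exact ⟨hV ▸ hwm, hVb.trans_lt hb.lt_top, hV ▸ hsol⟩
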